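/- For partitions $\mu,\nu,\lambda$, let $c_{\mu,\nu}^{\lambda}$ be the Littlewood--Richardson coefficient, i.e. the number of semistandard tableaux of skew shape $\lambda/\mu$ and content $\nu$ whose right-to-left, top-to-bottom row reading word is ballot (and $c_{\mu,\nu}^{\lambda}=0$ if $\mu\not\subseteq\lambda$). The Newell--Littlewood numbers are $$N_{\mu,\nu,\lambda}=\sum_{\alpha,\beta,\gamma} c_{\alpha,\beta}^{\mu}\,c_{\alpha,\gamma}^{\nu}\,c_{\beta,\gamma}^{\lambda},$$ the sum being over all triples of partitions. Let $\mathsf{Par}_n$ be the set of partitions with at most $n$ nonzero parts, and let $\mathsf{NL}_n=\{(\mu,\nu,\lambda)\in\mathsf{Par}_n^3 : N_{\mu,\nu,\lambda}>0\}$. **Theorem.** Suppose $\lambda,\mu,\nu\in\mathsf{Par}_2$ satisfy $|\lambda|+|\mu|+|\nu|\equiv 0 \pmod 2$ and the triangle inequalities $|\lambda|\le|\mu|+|\nu|$, $|\nu|\le|\mu|+|\lambda|$, $|\mu|\le|\lambda|+|\nu|$. Then $(\mu,\nu,\lambda)\in\mathsf{NL}_2$ if and only if all of the following inequalities hold: $$\lambda_1\leq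 \mu_1+\nu_1,\quad \nu_1\leq \lambda_1+\mu_1,\quad \mu_1\leq \lambda_1+\nu_1,$$ $$\lambda_2\leq \mu_1+\nu_2,\quad \nu_2\leq \lambda_1+\mu_2,\quad \mu_2\leq \lambda_1+\nu_2,$$ $$\lambda_2\leq \mu_2+\nu_1,\quad \nu_2\leq \lambda_2+\mu_1,\quad \mu_2\leq \lambda_2+\nu_1$$ (the Weyl/Horn inequalities and their symmetric versions), and $$\nu_1-\nu_2 \leq \mu_1+\mu_2 + \lambda_1 - \lambda_2,\quad \mu_1-\mu_2\leq \lambda_1+\lambda_2+\nu_1-\nu_2,\quad \lambda_1-\lambda_2\leq \nu_1+\nu_2+\mu_1-\mu_2,$$ $$\lambda_1-\lambda_2\leq \mu_1+\mu_2+\nu_1-\nu_2,\quad \mu_1-\mu_2\leq \nu_1+\nu_2+\lambda_1-\lambda_2,\quad \nu_1-\nu_2\leq \lambda_1+\lambda_2+\mu_1-\mu_2$$ (the extended Weyl inequalities). -/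

import Mathlib

/-- The boxes of the skew shape `lam / mu` (rows and columns indexed from `0`). -/
def skewCells (lam mu : YoungDiagram) : Finset (ℕ × ℕ) :=
  lam.cells \ mu.cells

/-- The boxes of `lam / mu` that are read up to and including the box `(i, j)`, when rows are
read from right to left and from top to bottom. -/
def readUpTo (lam mu : YoungDiagram) (i j : ℕ) : Finset (ℕ × ℕ) :=
  (skewCells lam mu).filter fun c => c.1 < i ∨ (c.1 = i ∧ j ≤ c.2)

/-- Littlewood-Richardson tableaux of shape `lam / mu` and content `nu`: semistandard fillings of
`lam / mu` by positive integers, whose right-to-left, top-to-bottom row reading word is ballot.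
A filling is a function `ℕ → ℕ → ℕ` which is required to be `0` outside the skew shape. -/
@[ext]
structure LRTableau (lam mu nu : YoungDiagram) where
  /-- The entry in row `i` and column `j`. -/
  entry : ℕ → ℕ → ℕ
  shape_le : mu ≤ lam
  entry_eq_zero : ∀ i j, (i, j) ∉ skewCells lam mu → entry i j = 0
  entry_pos : ∀ i j, (i, j) ∈ skewCells lam mu → 0 < entry i j
  row_weak : ∀ i j₁ j₂, j₁ < j₂ → (i, j₁) ∈ skewCells lam mu → (i, j₂) ∈ skewCells lam mu →
    entry i j₁ ≤ entry i j₂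
  col_strict : ∀ i₁ i₂ j, i₁ < i₂ → (i₁, j) ∈ skewCells lam mu → (i₂, j) ∈ skewCells lam mu →
    entry i₁ j < entry i₂ j
  /-- The letter `k + 1` occurs as often as the `(k + 1)`-st part of `nu` says. -/
  content : ∀ k, ((skewCells lam mu).filter fun c => entry c.1 c.2 = k + 1).card = nu.rowLen k
  /-- In every initial segment of the reading word, the letter `k ≥ 1` occurs at least as often
  as the letter `k + 1`. -/
  ballot : ∀ k, 1 ≤ k → ∀ i j, (i, j) ∈ skewCells lam mu →
    ((readUpTo lam mu i j).filter fun c => entry c.1 c.2 = k + 1).card ≤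
      ((readUpTo lam mu i j).filter fun c => entry c.1 c.2 = k).card

/-- The Littlewood-Richardson coefficient `c_{mu, nu}^{lam}`. -/
noncomputable def lrCoeff (mu nu lam : YoungDiagram) : ℕ :=
  Nat.card (LRTableau lam mu nu)

/-- The Newell-Littlewood number `N_{mu, nu, lam}`, the sum over all triples `(α, β, γ)` of
partitions of `c_{α, β}^{mu} * c_{α, γ}^{nu} * c_{β, γ}^{lam}`. Only finitely many terms are
nonzero, see `newellLittlewood_support_finite`. -/
noncomputable def newellLittlewood (mu nu lam : YoungDiagram) : ℕ :=
  ∑ᶠ t : YoungDiagram × YoungDiagram × YoungDiagram,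
    lrCoeff t.1 t.2.1 mu * lrCoeff t.1 t.2.2 nu * lrCoeff t.2.1 t.2.2 lam

/-- The partitions with at most `n` nonzero parts. -/
def Par (n : ℕ) : Set YoungDiagram :=
  {lam | lam.colLen 0 ≤ n}

/-- The Newell-Littlewood semigroup `NL_n`. -/
def NL (n : ℕ) : Set (YoungDiagram × YoungDiagram × YoungDiagram) :=
  {t | t.1 ∈ Par n ∧ t.2.1 ∈ Par n ∧ t.2.2 ∈ Par n ∧ 0 < newellLittlewood t.1 t.2.1 t.2.2}

theorem YoungDiagram.sum_rowLen_range (nu : YoungDiagram) {m : ℕ} (hm : nu.colLen 0 ≤ m) :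
    ∑ k ∈ Finset.range m, nu.rowLen k = nu.card := by
  classical
  have hmap : ∀ c ∈ nu.cells, c.1 ∈ Finset.range m := by
    intro c hc
    have h0 : (c.1, 0) ∈ nu := nu.up_left_mem le_rfl (Nat.zero_le c.2) (show (c.1, c.2) ∈ nu from hc)
    have := YoungDiagram.mem_iff_lt_colLen.1 h0
    exact Finset.mem_range.2 (by omega)
  have h := Finset.card_eq_sum_card_fiberwise hmap
  rw [YoungDiagram.card, h]
  refine Finset.sum_congr rfl fun k _ => ?_
  rw [YoungDiagram.rowLen_eq_card]
  rfl

/-- The content of a Littlewood-Richardson tableau has size at most that of the outer shape. -/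
theorem LRTableau.card_content_le {lam mu nu : YoungDiagram} (T : LRTableau lam mu nu) :
    nu.card ≤ lam.card := by
  classical
  rw [← nu.sum_rowLen_range le_rfl, ← Finset.sum_congr rfl fun k _ => T.content k]
  rw [← Finset.card_biUnion]
  · refine Finset.card_le_card fun c hc => ?_
    simp only [Finset.mem_biUnion, Finset.mem_filter] at hc
    obtain ⟨_, _, hc, _⟩ := hc
    exact (Finset.mem_sdiff.1 hc).1
  · intro a _ b _ hab
    refine Finset.disjoint_left.2 fun c hc hc' => hab ?_
    have h1 := (Finset.mem_filter.1 hc).2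
    have h2 := (Finset.mem_filter.1 hc').2
    omega

theorem LRTableau.entry_le {lam mu nu : YoungDiagram} (T : LRTableau lam mu nu) (i j : ℕ) :
    T.entry i j ≤ lam.card := by
  classical
  by_cases hc : (i, j) ∈ skewCells lam mu
  · obtain ⟨k, hk⟩ : ∃ k, T.entry i j = k + 1 := ⟨_, (Nat.succ_pred (T.entry_pos i j hc).ne').symm⟩
    have hpos : 0 < nu.rowLen k := by
      rw [← T.content k]
      exact Finset.card_pos.2 ⟨(i, j), Finset.mem_filter.2 ⟨hc, hk⟩⟩
    have h1 : (k, 0) ∈ nu := YoungDiagram.mem_iff_lt_rowLen.2 hpos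
    have h2 : k < nu.colLen 0 := YoungDiagram.mem_iff_lt_colLen.1 h1
    have h3 : nu.colLen 0 ≤ nu.card := by
      rw [YoungDiagram.colLen_eq_card]
      exact Finset.card_le_card (Finset.filter_subset _ _)
    have h4 := T.card_content_le
    omega
  · rw [T.entry_eq_zero i j hc]
    exact Nat.zero_le _

instance (lam mu nu : YoungDiagram) : Finite (LRTableau lam mu nu) := by
  classical
  refine Finite.of_injective
    (fun (T : LRTableau lam mu nu) (c : {c // c ∈ skewCells lam mu}) =>
      (⟨T.entry c.1.1 c.1.2, Nat.lt_succ_of_le (T.entry_le _ _)⟩ : Fin (lam.card + 1))) ?_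
  intro T T' h
  ext i j
  by_cases hc : (i, j) ∈ skewCells lam mu
  · exact congrArg Fin.val (congrFun h ⟨(i, j), hc⟩)
  · rw [T.entry_eq_zero i j hc, T'.entry_eq_zero i j hc]

theorem lrCoeff_pos_iff {mu nu lam : YoungDiagram} :
    0 < lrCoeff mu nu lam ↔ Nonempty (LRTableau lam mu nu) := by
  rw [lrCoeff, Nat.card_pos_iff]
  exact and_iff_left inferInstance

theorem YoungDiagram.finite_card_le (m : ℕ) : {nu : YoungDiagram | nu.card ≤ m}.Finite := by
  classical
  refine Set.Finite.of_finite_image (f := YoungDiagram.cells)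
    ((Finset.range m ×ˢ Finset.range m).powerset.finite_toSet.subset ?_) ?_
  · rintro _ ⟨nu, hnu, rfl⟩
    rw [Finset.mem_coe, Finset.mem_powerset]
    intro c hc
    have hnu' : nu.card ≤ m := hnu
    have hr : nu.rowLen c.1 ≤ nu.card := by
      rw [YoungDiagram.rowLen_eq_card]
      exact Finset.card_le_card (Finset.filter_subset _ _)
    have hl : nu.colLen c.2 ≤ nu.card := by
      rw [YoungDiagram.colLen_eq_card]
      exact Finset.card_le_card (Finset.filter_subset _ _)
    have h1 := YoungDiagram.mem_iff_lt_rowLen.1 (show (c.1, c.2) ∈ nu from hc)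
    have h2 := YoungDiagram.mem_iff_lt_colLen.1 (show (c.1, c.2) ∈ nu from hc)
    rw [Finset.mem_product, Finset.mem_range, Finset.mem_range]
    omega
  · intro a _ b _ h
    exact YoungDiagram.ext h

/-- Only finitely many terms in the sum that defines a Newell-Littlewood number are nonzero. -/
theorem newellLittlewood_support_finite (mu nu lam : YoungDiagram) :
    (Function.support fun t : YoungDiagram × YoungDiagram × YoungDiagram =>
      lrCoeff t.1 t.2.1 mu * lrCoeff t.1 t.2.2 nu * lrCoeff t.2.1 t.2.2 lam).Finite := by
  refine ((YoungDiagram.finite_card_le mu.card).prod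
    ((YoungDiagram.finite_card_le mu.card).prod (YoungDiagram.finite_card_le nu.card))).subset ?_
  rintro ⟨a, b, c⟩ h
  have h' : (lrCoeff a b mu ≠ 0 ∧ lrCoeff a c nu ≠ 0) ∧ lrCoeff b c lam ≠ 0 := by
    simpa only [Function.mem_support, mul_ne_zero_iff] using h
  obtain ⟨T⟩ := lrCoeff_pos_iff.1 (Nat.pos_of_ne_zero h'.1.1)
  obtain ⟨U⟩ := lrCoeff_pos_iff.1 (Nat.pos_of_ne_zero h'.1.2)
  exact ⟨Finset.card_le_card T.shape_le, T.card_content_le, U.card_content_le⟩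

/-! A sum of naturals is positive iff some term is, so the question is whether α, β, γ exist with
all three Littlewood–Richardson coefficients positive. For shapes with at most two rows, positivity
amounts to the size equation and three linear inequalities (`lrCoeff_pos_iff_of_mem_Par_two`). The
size equations force |α|, |β|, |γ|; parity and the triangle inequalities make these natural numbers.
Only the second parts x, y, z remain free, subject to linear constraints.

Necessity is then linear arithmetic. Sufficiency is Fourier–Motzkin elimination
(`exists_second_parts`). It is exact over ℤ because the variable being eliminated always has
coefficient 1 in its lower bounds; the coefficient 2 occurs only in upper bounds, so the largest
lower bound is an integer solution (`exists_int_between`). -/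

/-! ### Integer Fourier–Motzkin elimination -/

theorem exists_int_between (L U V : List ℤ) (h : ∀ l ∈ L, (∀ u ∈ U, l ≤ u) ∧ ∀ v ∈ V, 2 * l ≤ v) :
    ∃ z, (∀ l ∈ L, l ≤ z) ∧ (∀ u ∈ U, z ≤ u) ∧ ∀ v ∈ V, 2 * z ≤ v := by
  have hbelow : ∀ W : List ℤ, ∃ z, ∀ w ∈ W, z ≤ w := fun W => by
    induction W with
    | nil => exact ⟨0, by simp⟩
    | cons v W ih =>
      obtain ⟨z, hz⟩ := ih
      refine ⟨min v z, fun w hw => ?_⟩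
      rcases List.mem_cons.1 hw with rfl | hw
      · exact min_le_left _ _
      · exact (min_le_right _ _).trans (hz w hw)
  induction L with
  | nil =>
    obtain ⟨z, hz⟩ := hbelow U
    obtain ⟨z', hz'⟩ := hbelow V
    -- The 0 makes the value nonpositive, so that doubling it cannot exceed `z'`, whatever the sign
    -- of `z'`.
    refine ⟨min z (min z' 0), by simp, fun u hu => ?_, fun v hv => ?_⟩
    · have := hz u hu
      omega
    · have := hz' v hv
      omega
  | cons k L ih =>
    obtain ⟨z, hz, hz', hz''⟩ := ih fun l hl => h l (List.mem_cons_of_mem _ hl)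
    have hk := h k List.mem_cons_self
    refine ⟨max k z, fun l hl => ?_, fun u hu => max_le (hk.1 u hu) (hz' u hu), fun v hv => ?_⟩
    · rcases List.mem_cons.1 hl with rfl | hl
      · exact le_max_left _ _
      · exact (hz l hl).trans (le_max_right _ _)
    · have := hk.2 v hv
      have := hz'' v hv
      omega

/-- The second parts `x`, `y`, `z` of three partitions of `A`, `B`, `C` with at most two parts
whose three Littlewood-Richardson coefficients are nonzero. -/
theorem exists_second_parts {A B C l₁ l₂ m₁ m₂ n₁ n₂ : ℤ} (hA : 0 ≤ A) (hB : 0 ≤ B) (hC : 0 ≤ C)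
    (hl₀ : 0 ≤ l₂) (hm₀ : 0 ≤ m₂) (hn₀ : 0 ≤ n₂) (hl : l₂ ≤ l₁) (hm : m₂ ≤ m₁) (hn : n₂ ≤ n₁)
    (hAB : A + B = m₁ + m₂) (hAC : A + C = n₁ + n₂) (hBC : B + C = l₁ + l₂)
    (h : (l₁ ≤ m₁ + n₁ ∧ n₁ ≤ l₁ + m₁ ∧ m₁ ≤ l₁ + n₁) ∧
      (l₂ ≤ m₁ + n₂ ∧ n₂ ≤ l₁ + m₂ ∧ m₂ ≤ l₁ + n₂) ∧
      (l₂ ≤ m₂ + n₁ ∧ n₂ ≤ l₂ + m₁ ∧ m₂ ≤ l₂ + n₁) ∧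
      (n₁ - n₂ ≤ m₁ + m₂ + l₁ - l₂ ∧
        m₁ - m₂ ≤ l₁ + l₂ + n₁ - n₂ ∧
        l₁ - l₂ ≤ n₁ + n₂ + m₁ - m₂ ∧
        l₁ - l₂ ≤ m₁ + m₂ + n₁ - n₂ ∧
        m₁ - m₂ ≤ n₁ + n₂ + l₁ - l₂ ∧
        n₁ - n₂ ≤ l₁ + l₂ + m₁ - m₂)) :
    ∃ x y z : ℤ, (0 ≤ x ∧ 2 * x ≤ A) ∧ (0 ≤ y ∧ 2 * y ≤ B) ∧ (0 ≤ z ∧ 2 * z ≤ C) ∧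
      (x + y ≤ m₂ ∧ A - m₁ ≤ x - y ∧ x - y ≤ m₁ - B) ∧
      (x + z ≤ n₂ ∧ A - n₁ ≤ x - z ∧ x - z ≤ n₁ - C) ∧
      (y + z ≤ l₂ ∧ B - l₁ ≤ y - z ∧ y - z ≤ l₁ - C) := by
  obtain ⟨⟨_, _, _⟩, ⟨_, _, _⟩, ⟨_, _, _⟩, _, _, _, _, _, _⟩ := h
  -- Elimination runs z, y, x and the solution is rebuilt in the opposite order. The bounds on z
  -- come straight from the goal. Those on y add the comparisons of lower with upper bounds on z,
  -- and those on x do the same for y. The bounds on x are compatible by the hypotheses.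
  obtain ⟨x, hx⟩ := exists_int_between
    [0, A - n₁, A - m₁, A - n₁ - l₁ + C, A - m₁ + B - l₁, A - n₁ - 2 * l₁ + C + B]
    [n₂, m₂, l₂ + n₁ - C, n₂ + l₁ - C, l₂ + m₁ - B, m₂ + l₁ - B, n₂ + 2 * l₁ - C - B, n₁]
    [A, 2 * n₁ - C, 2 * m₁ - B, l₂ + n₁ - C + m₁ - B, 2 * l₁ - C + 2 * m₁ - 2 * B,
      n₂ + l₁ - C + m₁ - B, 2 * n₁ - 2 * C - B + 2 * l₁, m₂ + n₁ - C - B + l₁,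
      l₂ + 2 * n₁ - 2 * C - B + l₁, 2 * n₁ - 3 * C - 2 * B + 4 * l₁,
      n₂ + n₁ - 2 * C - B + 2 * l₁] (by
    simp only [List.forall_mem_cons, List.not_mem_nil, false_imp_iff, implies_true, and_true]
    (repeat' apply And.intro) <;> linarith)
  simp only [List.forall_mem_cons, List.not_mem_nil, false_imp_iff, implies_true, and_true] at hx
  obtain ⟨⟨_, _, _, _, _, _⟩, ⟨_, _, _, _, _, _, _, _⟩, _, _, _, _, _, _, _, _, _, _, _⟩ := hx
  obtain ⟨y, hy⟩ := exists_int_between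
    [0, x - m₁ + B, B - l₁, x - n₁ + C + B - l₁]
    [m₂ - x, x - A + m₁, l₂, l₂ + n₁ - C - x, n₂ + l₁ - C - x, x - A + n₁ + l₁ - C]
    [B, 2 * l₁ - C] (by
    simp only [List.forall_mem_cons, List.not_mem_nil, false_imp_iff, implies_true, and_true]
    (repeat' apply And.intro) <;> linarith)
  simp only [List.forall_mem_cons, List.not_mem_nil, false_imp_iff, implies_true, and_true] at hy
  obtain ⟨⟨_, _, _, _⟩, ⟨_, _, _, _, _, _⟩, _, _⟩ := hy
  obtain ⟨z, hz⟩ := exists_int_between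
    [0, x - n₁ + C, y - l₁ + C]
    [n₂ - x, l₂ - y, x - A + n₁, y - B + l₁]
    [C] (by
    simp only [List.forall_mem_cons, List.not_mem_nil, false_imp_iff, implies_true, and_true]
    (repeat' apply And.intro) <;> linarith)
  simp only [List.forall_mem_cons, List.not_mem_nil, false_imp_iff, implies_true, and_true] at hz
  obtain ⟨⟨_, _, _⟩, ⟨_, _, _, _⟩, _⟩ := hz
  refine ⟨x, y, z, ?_⟩
  (repeat' apply And.intro) <;> linarith

/-! ### Row lengths, skew boxes and two-row partitions -/

theorem rowLen_eq_zero_of_mem_Par {n : ℕ} {lam : YoungDiagram} (h : lam ∈ Par n) {k : ℕ}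
    (hk : n ≤ k) : lam.rowLen k = 0 := by
  have h' : lam.colLen 0 ≤ n := h
  by_contra h0
  have h1 : (k, 0) ∈ lam := YoungDiagram.mem_iff_lt_rowLen.2 (Nat.pos_of_ne_zero h0)
  have := YoungDiagram.mem_iff_lt_colLen.1 h1
  omega

theorem mem_Par_of_rowLen_eq_zero {n : ℕ} {lam : YoungDiagram} (h : lam.rowLen n = 0) :
    lam ∈ Par n := by
  change lam.colLen 0 ≤ n
  by_contra hn
  have h1 : (n, 0) ∈ lam := YoungDiagram.mem_iff_lt_colLen.2 (not_le.1 hn)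
  have := YoungDiagram.mem_iff_lt_rowLen.1 h1
  omega

theorem card_eq_of_mem_Par_two {lam : YoungDiagram} (h : lam ∈ Par 2) :
    lam.card = lam.rowLen 0 + lam.rowLen 1 := by
  rw [← lam.sum_rowLen_range h, Finset.sum_range_succ, Finset.sum_range_one]

theorem rowLen_le_of_le {mu lam : YoungDiagram} (h : mu ≤ lam) (i : ℕ) :
    mu.rowLen i ≤ lam.rowLen i := by
  by_contra hi
  have h1 : (i, lam.rowLen i) ∈ mu := YoungDiagram.mem_iff_lt_rowLen.2 (not_le.1 hi)
  exact lt_irrefl _ (YoungDiagram.mem_iff_lt_rowLen.1 (h h1))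

theorem Par_of_le {n : ℕ} {mu lam : YoungDiagram} (h : mu ≤ lam) (hlam : lam ∈ Par n) :
    mu ∈ Par n :=
  mem_Par_of_rowLen_eq_zero <| Nat.le_zero.1 <|
    (rowLen_le_of_le h n).trans (rowLen_eq_zero_of_mem_Par hlam le_rfl).le

theorem mem_skewCells_iff {lam mu : YoungDiagram} {i j : ℕ} :
    (i, j) ∈ skewCells lam mu ↔ mu.rowLen i ≤ j ∧ j < lam.rowLen i := by
  rw [skewCells, Finset.mem_sdiff, YoungDiagram.mem_cells, YoungDiagram.mem_cells,
    YoungDiagram.mem_iff_lt_rowLen, YoungDiagram.mem_iff_lt_rowLen, not_lt, and_comm]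

theorem mem_readUpTo_iff {lam mu : YoungDiagram} {i j a b : ℕ} :
    (a, b) ∈ readUpTo lam mu i j ↔
      (mu.rowLen a ≤ b ∧ b < lam.rowLen a) ∧ (a < i ∨ (a = i ∧ j ≤ b)) := by
  rw [readUpTo, Finset.mem_filter, mem_skewCells_iff]

/-- The partition with parts `a ≥ b`. -/
def twoRows (a b : ℕ) (h : b ≤ a) : YoungDiagram where
  cells := ({0} ×ˢ Finset.range a) ∪ ({1} ×ˢ Finset.range b)
  isLowerSet := by
    rintro ⟨i, j⟩ ⟨i', j'⟩ ⟨h1, h2⟩ hc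
    simp only [Finset.coe_union, Finset.coe_product, Finset.coe_singleton, Finset.coe_range,
      Set.mem_union, Set.mem_prod, Set.mem_singleton_iff, Set.mem_Iio] at hc h1 h2 ⊢
    omega

theorem mem_twoRows {a b : ℕ} {h : b ≤ a} {i j : ℕ} :
    (i, j) ∈ twoRows a b h ↔ (i = 0 ∧ j < a) ∨ (i = 1 ∧ j < b) := by
  rw [← YoungDiagram.mem_cells]
  simp only [twoRows, Finset.mem_union, Finset.mem_product, Finset.mem_singleton, Finset.mem_range]

theorem rowLen_twoRows_zero {a b : ℕ} (h : b ≤ a) : (twoRows a b h).rowLen 0 = a := by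
  refine Nat.le_antisymm ?_ ?_ <;> refine le_of_forall_lt fun j hj => ?_
  · simpa [mem_twoRows] using YoungDiagram.mem_iff_lt_rowLen.2 hj
  · exact YoungDiagram.mem_iff_lt_rowLen.1 (mem_twoRows.2 (Or.inl ⟨rfl, hj⟩))

theorem rowLen_twoRows_one {a b : ℕ} (h : b ≤ a) : (twoRows a b h).rowLen 1 = b := by
  refine Nat.le_antisymm ?_ ?_ <;> refine le_of_forall_lt fun j hj => ?_
  · simpa [mem_twoRows] using YoungDiagram.mem_iff_lt_rowLen.2 hj
  · exact YoungDiagram.mem_iff_lt_rowLen.1 (mem_twoRows.2 (Or.inr ⟨rfl, hj⟩))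

theorem twoRows_mem_Par {a b : ℕ} (h : b ≤ a) : twoRows a b h ∈ Par 2 := by
  refine mem_Par_of_rowLen_eq_zero ?_
  by_contra h0
  simpa [mem_twoRows] using
    YoungDiagram.mem_iff_lt_rowLen.2 (Nat.pos_of_ne_zero h0)

/-! ### Positivity of Newell–Littlewood and Littlewood–Richardson numbers -/

theorem newellLittlewood_pos_iff {mu nu lam : YoungDiagram} :
    0 < newellLittlewood mu nu lam ↔ ∃ a b c, 0 < lrCoeff a b mu ∧ 0 < lrCoeff a c nu ∧
      0 < lrCoeff b c lam := by
  rw [newellLittlewood, finsum_eq_sum _ (newellLittlewood_support_finite mu nu lam),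
    Nat.pos_iff_ne_zero, Ne, Finset.sum_eq_zero_iff]
  simp only [Set.Finite.mem_toFinset, Function.mem_support, not_forall]
  constructor
  · rintro ⟨⟨a, b, c⟩, h, -⟩
    simp only [ne_eq, mul_eq_zero, not_or] at h
    exact ⟨a, b, c, Nat.pos_of_ne_zero h.1.1, Nat.pos_of_ne_zero h.1.2, Nat.pos_of_ne_zero h.2⟩
  · rintro ⟨a, b, c, h1, h2, h3⟩
    have := (Nat.mul_pos (Nat.mul_pos h1 h2) h3).ne'
    exact ⟨(a, b, c), this, this⟩

/-- The rightmost box of a row is its largest entry and the first one read. By the ballot condition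
there, an entry `k + 1` with `k > i` needs an earlier `k`, but all earlier rows have entries at most
`i`. -/
theorem LRTableau.entry_le_succ {lam mu nu : YoungDiagram} (T : LRTableau lam mu nu) (i j : ℕ) :
    T.entry i j ≤ i + 1 := by
  induction i using Nat.strong_induction_on generalizing j with
  | _ i ih =>
    by_cases hc : (i, j) ∈ skewCells lam mu
    swap
    · rw [T.entry_eq_zero i j hc]
      exact Nat.zero_le _
    by_contra hlt
    have hj := mem_skewCells_iff.1 hc
    have hc' : (i, lam.rowLen i - 1) ∈ skewCells lam mu := mem_skewCells_iff.2 (by omega)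
    have hle : T.entry i j ≤ T.entry i (lam.rowLen i - 1) := by
      rcases (show j ≤ lam.rowLen i - 1 by omega).lt_or_eq with h | h
      · exact T.row_weak _ _ _ h hc hc'
      · rw [← h]
    obtain ⟨k, hk⟩ : ∃ k, T.entry i (lam.rowLen i - 1) = k + 1 := ⟨_, (Nat.sub_add_cancel (by omega)).symm⟩
    have hb := T.ballot k (by omega) i _ hc'
    have hpos : 0 < ((readUpTo lam mu i (lam.rowLen i - 1)).filter
        fun c => T.entry c.1 c.2 = k + 1).card :=
      Finset.card_pos.2 ⟨(i, lam.rowLen i - 1), Finset.mem_filter.2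
        ⟨mem_readUpTo_iff.2 ⟨mem_skewCells_iff.1 hc', Or.inr ⟨rfl, le_rfl⟩⟩, hk⟩⟩
    obtain ⟨⟨a, b⟩, hab⟩ := Finset.card_pos.1 (hpos.trans_le hb)
    obtain ⟨hab, hk'⟩ := Finset.mem_filter.1 hab
    obtain ⟨hab, ha | ⟨rfl, hb'⟩⟩ := mem_readUpTo_iff.1 hab
    · have := ih a ha b
      simp only at hk'
      omega
    · obtain rfl : b = lam.rowLen a - 1 := by omega
      simp only at hk'
      omega

section

variable {mu a b : YoungDiagram}

theorem row_lt_two_of_mem_skewCells (hmu : mu ∈ Par 2) {i j : ℕ}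
    (h : (i, j) ∈ skewCells mu a) : i < 2 := by
  by_contra hi
  have := rowLen_eq_zero_of_mem_Par hmu (not_lt.1 hi)
  have := mem_skewCells_iff.1 h
  omega

theorem LRTableau.content_mem_Par_two (T : LRTableau mu a b) (hmu : mu ∈ Par 2) : b ∈ Par 2 := by
  refine mem_Par_of_rowLen_eq_zero ?_
  rw [← T.content 2, Finset.card_eq_zero, Finset.filter_eq_empty_iff]
  rintro ⟨i, j⟩ h h'
  have := row_lt_two_of_mem_skewCells hmu h
  have := T.entry_le_succ i j
  simp only at h'
  omega

theorem LRTableau.rowLen_add (T : LRTableau mu a b) (hmu : mu ∈ Par 2) :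
    a.rowLen 0 + a.rowLen 1 + (b.rowLen 0 + b.rowLen 1) = mu.rowLen 0 + mu.rowLen 1 := by
  rw [← card_eq_of_mem_Par_two hmu, ← card_eq_of_mem_Par_two (Par_of_le T.shape_le hmu),
    ← T.content 0, ← T.content 1, ← Finset.card_union_of_disjoint, ← Finset.filter_or,
    Finset.filter_true_of_mem, skewCells, add_comm]
  · exact Finset.card_sdiff_add_card_eq_card T.shape_le
  · rintro ⟨i, j⟩ h
    have := row_lt_two_of_mem_skewCells hmu h
    have := T.entry_le_succ i j
    have := T.entry_pos i j h
    simp only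
    omega
  · refine Finset.disjoint_filter.2 fun c _ h => ?_
    omega

theorem LRTableau.row_eq_one_of_entry_eq_two (T : LRTableau mu a b) (hmu : mu ∈ Par 2) {i j : ℕ}
    (h : (i, j) ∈ skewCells mu a) (h2 : T.entry i j = 2) : i = 1 := by
  have := row_lt_two_of_mem_skewCells hmu h
  have := T.entry_le_succ i j
  omega

/-- All letters 2 lie in the second row of the skew shape. -/
theorem LRTableau.rowLen_one_add_rowLen_one_le (T : LRTableau mu a b) (hmu : mu ∈ Par 2) :
    a.rowLen 1 + b.rowLen 1 ≤ mu.rowLen 1 := by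
  have hle := rowLen_le_of_le T.shape_le 1
  have : b.rowLen 1 ≤ (({1} : Finset ℕ) ×ˢ Finset.Ico (a.rowLen 1) (mu.rowLen 1)).card := by
    rw [← T.content 1]
    refine Finset.card_le_card ?_
    rintro ⟨i, j⟩ h
    obtain ⟨h, h2⟩ := Finset.mem_filter.1 h
    obtain rfl := T.row_eq_one_of_entry_eq_two hmu h h2
    simpa using mem_skewCells_iff.1 h
  rw [Finset.card_product, Finset.card_singleton, Nat.card_Ico] at this
  omega

/-- The letters 1 lie in distinct columns, and every column of the skew shape has index at least
`a.rowLen 1` and below `mu.rowLen 0`. -/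
theorem LRTableau.rowLen_one_add_rowLen_zero_le (T : LRTableau mu a b) (hmu : mu ∈ Par 2) :
    a.rowLen 1 + b.rowLen 0 ≤ mu.rowLen 0 := by
  have ha := a.rowLen_anti 0 1 (Nat.zero_le 1)
  have hm := mu.rowLen_anti 0 1 (Nat.zero_le 1)
  have hle := rowLen_le_of_le T.shape_le 0
  have : b.rowLen 0 ≤ (Finset.Ico (a.rowLen 1) (mu.rowLen 0)).card := by
    rw [← T.content 0]
    refine Finset.card_le_card_of_injOn Prod.snd ?_ ?_
    · rintro ⟨i, j⟩ h
      obtain ⟨h, -⟩ := Finset.mem_filter.1 h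
      have hi := row_lt_two_of_mem_skewCells hmu h
      have := mem_skewCells_iff.1 h
      simp only [Finset.coe_Ico, Set.mem_Ico]
      interval_cases i <;> omega
    · rintro ⟨i, j⟩ h ⟨i', j'⟩ h' (rfl : j = j')
      obtain ⟨h, he⟩ := Finset.mem_filter.1 h
      obtain ⟨h', he'⟩ := Finset.mem_filter.1 h'
      simp only at he he'
      rcases lt_trichotomy i i' with hi | rfl | hi
      · have := T.col_strict _ _ _ hi h h'
        omega
      · rfl
      · have := T.col_strict _ _ _ hi h' h
        omega
  rw [Nat.card_Ico] at this
  omega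

/-- Apply the ballot condition at the leftmost 2. Every 2 has been read by then, while the letters 1
read so far all lie in the first row, since rows increase weakly. -/
theorem LRTableau.rowLen_zero_add_rowLen_one_le (T : LRTableau mu a b) (hmu : mu ∈ Par 2) :
    a.rowLen 0 + b.rowLen 1 ≤ mu.rowLen 0 := by
  have hle := rowLen_le_of_le T.shape_le 0
  rcases ((skewCells mu a).filter fun c => T.entry c.1 c.2 = 1 + 1).eq_empty_or_nonempty with h0 | h0
  · rw [← T.content 1, h0, Finset.card_empty]
    omega
  obtain ⟨⟨i, j⟩, hij, hmin⟩ := Finset.exists_min_image _ Prod.snd h0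
  obtain ⟨hij, h2⟩ := Finset.mem_filter.1 hij
  obtain rfl := T.row_eq_one_of_entry_eq_two hmu hij h2
  have h1 : b.rowLen 1 ≤
      ((readUpTo mu a 1 j).filter fun c => T.entry c.1 c.2 = 1 + 1).card := by
    rw [← T.content 1]
    refine Finset.card_le_card ?_
    rintro ⟨i', j'⟩ h
    have hj := hmin _ h
    obtain ⟨h, h2'⟩ := Finset.mem_filter.1 h
    obtain rfl := T.row_eq_one_of_entry_eq_two hmu h h2'
    exact Finset.mem_filter.2 ⟨mem_readUpTo_iff.2 ⟨mem_skewCells_iff.1 h, Or.inr ⟨rfl, hj⟩⟩, h2'⟩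
  have h3 : ((readUpTo mu a 1 j).filter fun c => T.entry c.1 c.2 = 1).card ≤
      (({0} : Finset ℕ) ×ˢ Finset.Ico (a.rowLen 0) (mu.rowLen 0)).card := by
    refine Finset.card_le_card ?_
    rintro ⟨i', j'⟩ h
    obtain ⟨h, he⟩ := Finset.mem_filter.1 h
    obtain ⟨h, hlt | ⟨rfl, hj⟩⟩ := mem_readUpTo_iff.1 h
    · obtain rfl : i' = 0 := by omega
      simpa using h
    · exfalso
      simp only at he h2
      rcases hj.lt_or_eq with hj | rfl
      · have := T.row_weak _ _ _ hj hij (mem_skewCells_iff.2 h)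
        omega
      · omega
  have := T.ballot 1 le_rfl 1 j hij
  rw [Finset.card_product, Finset.card_singleton, Nat.card_Ico] at h3
  omega

/-- The Littlewood-Richardson tableau of an at most two-rowed shape: the first row is filled with
`1`, and the second row ends with `b.rowLen 1` letters `2`. -/
noncomputable def LRTableau.ofTwoRows (hmu : mu ∈ Par 2) (ha : a ∈ Par 2) (hb : b ∈ Par 2)
    (hsum : a.rowLen 0 + a.rowLen 1 + (b.rowLen 0 + b.rowLen 1) = mu.rowLen 0 + mu.rowLen 1)
    (h11 : a.rowLen 1 + b.rowLen 1 ≤ mu.rowLen 1) (h10 : a.rowLen 1 + b.rowLen 0 ≤ mu.rowLen 0)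
    (h01 : a.rowLen 0 + b.rowLen 1 ≤ mu.rowLen 0) : LRTableau mu a b :=
  have hval : ∀ {i j k : ℕ}, (i, j) ∈ skewCells mu a →
      (if (i, j) ∈ skewCells mu a then
        if i = 0 ∨ j < mu.rowLen 1 - b.rowLen 1 then 1 else 2 else 0) = k →
      k = 1 ∧ (i = 0 ∨ j < mu.rowLen 1 - b.rowLen 1) ∨
        k = 2 ∧ i ≠ 0 ∧ mu.rowLen 1 - b.rowLen 1 ≤ j := fun {i j k} h he => by
    rw [if_pos h] at he
    split_ifs at he <;> omega
  { entry := fun i j => if (i, j) ∈ skewCells mu a then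
      if i = 0 ∨ j < mu.rowLen 1 - b.rowLen 1 then 1 else 2 else 0
    shape_le := by
      rintro ⟨i, j⟩ h
      have hi := YoungDiagram.mem_iff_lt_rowLen.1 h
      refine YoungDiagram.mem_iff_lt_rowLen.2 ?_
      rcases Nat.lt_or_ge i 2 with h2 | h2
      · interval_cases i <;> omega
      · have := rowLen_eq_zero_of_mem_Par ha h2
        omega
    entry_eq_zero := fun i j h => if_neg h
    entry_pos := fun i j h => by
      rw [if_pos h]
      split_ifs <;> omega
    row_weak := fun i j₁ j₂ hj h₁ h₂ => by
      rw [if_pos h₁, if_pos h₂]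
      split_ifs <;> omega
    col_strict := fun i₁ i₂ j hi h₁ h₂ => by
      rw [if_pos h₁, if_pos h₂]
      have hi₁ := row_lt_two_of_mem_skewCells hmu h₁
      have hi₂ := row_lt_two_of_mem_skewCells hmu h₂
      obtain rfl : i₁ = 0 := by omega
      obtain rfl : i₂ = 1 := by omega
      have := mem_skewCells_iff.1 h₁
      -- With `hsum`, `h10` says `mu.rowLen 1 ≤ a.rowLen 0 + b.rowLen 1`, so a box below a first-row
      -- box lies in the stretch of letters 2.
      rw [if_pos (Or.inl rfl), if_neg (by omega)]
      exact one_lt_two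
    content := fun k => by
      have hk : k = 0 ∨ k = 1 ∨ 2 ≤ k := by omega
      rcases hk with rfl | rfl | hk
      · trans (({0} : Finset ℕ) ×ˢ Finset.Ico (a.rowLen 0) (mu.rowLen 0) ∪
          {1} ×ˢ Finset.Ico (a.rowLen 1) (mu.rowLen 1 - b.rowLen 1)).card
        · congr 1
          ext ⟨i, j⟩
          simp only [Finset.mem_filter, Finset.mem_union, Finset.mem_product,
            Finset.mem_singleton, Finset.mem_Ico]
          constructor
          · rintro ⟨h, he⟩
            have := mem_skewCells_iff.1 h
            have := hval h he
            have hi := row_lt_two_of_mem_skewCells hmu h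
            interval_cases i <;> omega
          · rintro (⟨rfl, h⟩ | ⟨rfl, h⟩)
            · have h' := mem_skewCells_iff.2 h
              exact ⟨h', by rw [if_pos h', if_pos (Or.inl rfl)]⟩
            · have h' : (1, j) ∈ skewCells mu a := mem_skewCells_iff.2 (by omega)
              exact ⟨h', by rw [if_pos h', if_pos (Or.inr h.2)]⟩
        · rw [Finset.card_union_of_disjoint, Finset.card_product, Finset.card_product,
            Finset.card_singleton, Finset.card_singleton, Nat.card_Ico, Nat.card_Ico]
          · omega
          · refine Finset.disjoint_left.2 ?_
            rintro ⟨i, j⟩ h h'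
            simp only [Finset.mem_product, Finset.mem_singleton] at h h'
            omega
      · trans (({1} : Finset ℕ) ×ˢ Finset.Ico (mu.rowLen 1 - b.rowLen 1) (mu.rowLen 1)).card
        · congr 1
          ext ⟨i, j⟩
          simp only [Finset.mem_filter, Finset.mem_product, Finset.mem_singleton, Finset.mem_Ico]
          constructor
          · rintro ⟨h, he⟩
            have := mem_skewCells_iff.1 h
            have := hval h he
            have hi := row_lt_two_of_mem_skewCells hmu h
            interval_cases i <;> omega
          · rintro ⟨rfl, h⟩
            have h' : (1, j) ∈ skewCells mu a := mem_skewCells_iff.2 (by omega)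
            exact ⟨h', by rw [if_pos h', if_neg (by omega)]⟩
        · rw [Finset.card_product, Finset.card_singleton, Nat.card_Ico]
          omega
      · rw [rowLen_eq_zero_of_mem_Par hb hk, Finset.card_eq_zero, Finset.filter_eq_empty_iff]
        rintro ⟨i, j⟩ h he
        have := hval h he
        omega
    ballot := fun k hk i j hij => by
      rw [← not_lt]
      intro hlt
      obtain ⟨⟨i', j'⟩, h0⟩ := Finset.card_pos.1 (Nat.zero_lt_of_lt hlt)
      obtain ⟨h0, he⟩ := Finset.mem_filter.1 h0
      have hc := (Finset.mem_filter.1 h0).1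
      have h0 := (mem_readUpTo_iff.1 h0).2
      obtain rfl : k = 1 := by
        have := hval hc he
        omega
      have hi := row_lt_two_of_mem_skewCells hmu hij
      have hi' := row_lt_two_of_mem_skewCells hmu hc
      obtain rfl : i = 1 := by
        have := hval hc he
        omega
      -- The whole first row, all 1s, has been read, and by `h01` it is at least as long as the
      -- stretch of letters 2.
      refine hlt.not_ge ?_
      trans (({1} : Finset ℕ) ×ˢ Finset.Ico (mu.rowLen 1 - b.rowLen 1) (mu.rowLen 1)).card
      · refine Finset.card_le_card ?_
        rintro ⟨i', j'⟩ h
        obtain ⟨h, he⟩ := Finset.mem_filter.1 h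
        have hc := (Finset.mem_filter.1 h).1
        have := mem_skewCells_iff.1 hc
        have := hval hc he
        simp only [Finset.mem_product, Finset.mem_singleton, Finset.mem_Ico]
        have hi := row_lt_two_of_mem_skewCells hmu hc
        interval_cases i' <;> omega
      trans (({0} : Finset ℕ) ×ˢ Finset.Ico (a.rowLen 0) (mu.rowLen 0)).card
      · rw [Finset.card_product, Finset.card_product, Finset.card_singleton,
          Finset.card_singleton, Nat.card_Ico, Nat.card_Ico]
        omega
      · refine Finset.card_le_card ?_
        rintro ⟨i', j'⟩ h
        simp only [Finset.mem_product, Finset.mem_singleton, Finset.mem_Ico] at h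
        obtain ⟨rfl, h⟩ := h
        have h' := mem_skewCells_iff.2 h
        exact Finset.mem_filter.2 ⟨mem_readUpTo_iff.2 ⟨h, Or.inl one_pos⟩, by
          rw [if_pos h', if_pos (Or.inl rfl)]⟩ }

/-- These are the Horn inequalities for n = 2. They turn the existence of tableaux into linear
conditions on row lengths. -/
theorem lrCoeff_pos_iff_of_mem_Par_two (hmu : mu ∈ Par 2) :
    0 < lrCoeff a b mu ↔ a ∈ Par 2 ∧ b ∈ Par 2 ∧
      a.rowLen 0 + a.rowLen 1 + (b.rowLen 0 + b.rowLen 1) = mu.rowLen 0 + mu.rowLen 1 ∧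
      a.rowLen 1 + b.rowLen 1 ≤ mu.rowLen 1 ∧ a.rowLen 1 + b.rowLen 0 ≤ mu.rowLen 0 ∧
      a.rowLen 0 + b.rowLen 1 ≤ mu.rowLen 0 := by
  rw [lrCoeff_pos_iff]
  constructor
  · rintro ⟨T⟩
    exact ⟨Par_of_le T.shape_le hmu, T.content_mem_Par_two hmu, T.rowLen_add hmu,
      T.rowLen_one_add_rowLen_one_le hmu, T.rowLen_one_add_rowLen_zero_le hmu,
      T.rowLen_zero_add_rowLen_one_le hmu⟩
  · rintro ⟨ha, hb, hsum, h11, h10, h01⟩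
    exact ⟨LRTableau.ofTwoRows hmu ha hb hsum h11 h10 h01⟩

end

/-! ### The characterization of `NL 2` -/

theorem theorem5p11 (mu nu lam : YoungDiagram)
    (hmu : mu ∈ Par 2) (hnu : nu ∈ Par 2) (hlam : lam ∈ Par 2)
    (heven : Even (lam.card + mu.card + nu.card))
    (htri₁ : lam.card ≤ mu.card + nu.card)
    (htri₂ : nu.card ≤ mu.card + lam.card)
    (htri₃ : mu.card ≤ lam.card + nu.card)
    (l₁ l₂ m₁ m₂ n₁ n₂ : ℤ)
    (hl₁ : l₁ = lam.rowLen 0) (hl₂ : l₂ = lam.rowLen 1)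
    (hm₁ : m₁ = mu.rowLen 0) (hm₂ : m₂ = mu.rowLen 1)
    (hn₁ : n₁ = nu.rowLen 0) (hn₂ : n₂ = nu.rowLen 1) :
    (mu, nu, lam) ∈ NL 2 ↔
      (l₁ ≤ m₁ + n₁ ∧ n₁ ≤ l₁ + m₁ ∧ m₁ ≤ l₁ + n₁) ∧
      (l₂ ≤ m₁ + n₂ ∧ n₂ ≤ l₁ + m₂ ∧ m₂ ≤ l₁ + n₂) ∧
      (l₂ ≤ m₂ + n₁ ∧ n₂ ≤ l₂ + m₁ ∧ m₂ ≤ l₂ + n₁) ∧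
      (n₁ - n₂ ≤ m₁ + m₂ + l₁ - l₂ ∧
        m₁ - m₂ ≤ l₁ + l₂ + n₁ - n₂ ∧
        l₁ - l₂ ≤ n₁ + n₂ + m₁ - m₂ ∧
        l₁ - l₂ ≤ m₁ + m₂ + n₁ - n₂ ∧
        m₁ - m₂ ≤ n₁ + n₂ + l₁ - l₂ ∧
        n₁ - n₂ ≤ l₁ + l₂ + m₁ - m₂) := by
  have hl := card_eq_of_mem_Par_two hlam
  have hm := card_eq_of_mem_Par_two hmu
  have hn := card_eq_of_mem_Par_two hnu
  have hl' := lam.rowLen_anti 0 1 (Nat.zero_le 1)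
  have hm' := mu.rowLen_anti 0 1 (Nat.zero_le 1)
  have hn' := nu.rowLen_anti 0 1 (Nat.zero_le 1)
  have hNL : (mu, nu, lam) ∈ NL 2 ↔ 0 < newellLittlewood mu nu lam :=
    ⟨fun h => h.2.2.2, fun h => ⟨hmu, hnu, hlam, h⟩⟩
  rw [hNL, newellLittlewood_pos_iff]
  simp only [lrCoeff_pos_iff_of_mem_Par_two hmu, lrCoeff_pos_iff_of_mem_Par_two hnu,
    lrCoeff_pos_iff_of_mem_Par_two hlam]
  constructor
  · rintro ⟨a, b, c, ⟨-, -, hab, _, _, _⟩, ⟨-, -, hac, _, _, _⟩, -, -, hbc, _, _, _⟩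
    have ha := a.rowLen_anti 0 1 (Nat.zero_le 1)
    have hb := b.rowLen_anti 0 1 (Nat.zero_le 1)
    have hc := c.rowLen_anti 0 1 (Nat.zero_le 1)
    zify at *
    subst hl₁ hl₂ hm₁ hm₂ hn₁ hn₂
    -- Each inequality is a linear consequence of the size equations, the Horn inequalities and the
    -- ordering of the parts of `a`, `b`, `c`.
    (repeat' apply And.intro) <;> linarith
  · intro h
    -- `A`, `B`, `C` are the forced sizes of α, β, γ, found by solving the three size equations.
    obtain ⟨A, hA⟩ : ∃ A, lam.card + 2 * A = mu.card + nu.card :=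
      ⟨(mu.card + nu.card - lam.card) / 2, by grind⟩
    obtain ⟨B, hB⟩ : ∃ B, nu.card + 2 * B = mu.card + lam.card :=
      ⟨(mu.card + lam.card - nu.card) / 2, by grind⟩
    obtain ⟨C, hC⟩ : ∃ C, mu.card + 2 * C = lam.card + nu.card :=
      ⟨(lam.card + nu.card - mu.card) / 2, by grind⟩
    obtain ⟨x, y, z, ⟨hx, hxA⟩, ⟨hy, hyB⟩, ⟨hz, hzC⟩, hxy, hxz, hyz⟩ :=
      exists_second_parts (A := A) (B := B) (C := C) (l₁ := l₁) (l₂ := l₂) (m₁ := m₁) (m₂ := m₂)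
        (n₁ := n₁) (n₂ := n₂) (by omega) (by omega) (by omega) (by omega) (by omega) (by omega)
        (by omega) (by omega) (by omega) (by omega) (by omega) (by omega) h
    clear h
    lift x to ℕ using hx
    lift y to ℕ using hy
    lift z to ℕ using hz
    -- The bounds `2 * x ≤ A` and its analogues put the parts in decreasing order and keep the
    -- natural subtractions exact.
    refine ⟨twoRows (A - x) x (by omega), twoRows (B - y) y (by omega),
      twoRows (C - z) z (by omega), ?_⟩
    simp only [twoRows_mem_Par, rowLen_twoRows_zero, rowLen_twoRows_one, true_and]
    refine ⟨⟨?_, ?_, ?_, ?_⟩, ⟨?_, ?_, ?_, ?_⟩, ?_, ?_, ?_, ?_⟩ <;> omega
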